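/- Let $\Omega\subset\mathbb R^d$ be a bounded domain and let $V$ be a real reflexive Banach space with $V\hookrightarrow L^2(\Omega)\hookrightarrow V'$, where $V\hookrightarrow L^2(\Omega)$ is a compact continuous injection and $L^2(\Omega)\hookrightarrow V'$ is the (injective) map $h\mapsto\int_\Omega h\,\cdot\,dx$. Let $A:V\to V'$ be a bounded linear elliptic operator (that is, $\langle Av,v\rangle\ge c\|v\|_V^2$ for all $v\in V$ with some $c>0$; $A$ need not be symmetric), let $A^*:V\to V'$, $\langle A^*p,v\rangle=\langle Av,p\rangle$, be its adjoint, and let $\alpha,\beta>0$, $z_d\in L^2(\Omega)$. Put $$J(u,f)=\tfrac12\int_\Omega|u-z_d|^2\,dx+\tfrac\alpha2\int_\Omega|f|^2\,dx .$$ Consider the problem $(\mathcal P)$ of minimizing $J(u,f)$ over $(u,f)\in V\times L^2(\Omega)$ subject to $$\langle Au,v-u\rangle+\beta\int_\Omega|v|\,dx-\beta\int_\Omega|u|\,dx\ge\int_\Omega f\,(v-u)\,dx\qquad\text{for all }v\in V,$$ and, for a family of convex functions $\phi_\gamma\in C^1(\mathbb R)$, $\gamma>0$, with $\phi_\gamma(x)\to\beta|x|$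 for every $x\in\mathbb R$ as $\gamma\to\infty$ (for example $\phi_\gamma(x)=\beta\sqrt{|x|^2+\gamma^{-2}}$ or $\phi_\gamma(x)=\frac{\beta}{\gamma+1}(\gamma|x|)^{(\gamma+1)/\gamma}$), the regularized problems $(\mathcal P_\gamma)$ of minimizing $J(u,f)$ over $(u,f)\in V\times L^2(\Omega)$ subject to $$\langle Au,v\rangle+\int_\Omega\phi_\gamma'(u)\,v\,dx=\int_\Omega f\,v\,dx\qquad\text{for all }v\in V$$ (where $\phi_\gamma'(u)\,v$ is required to be integrable for every $v\in V$). A control is a local optimal solution if, with a corresponding state, it is feasible and minimizes $J$ among all feasible pairs whose control lies in some $L^2(\Omega)$-ball around it. **Theorem.** Let $f\in L^2(\Omega)$ be a local optimal solution of $(\mathcal P)$ and $u\in V$ its corresponding state. Let $\gamma_n>0$ with $\gamma_n\to\infty$, and let $f_{\gamma_n}\in L^2(\Omega)$ be (local) optimal controls of $(\mathcal P_{\gamma_n})$ such that $f_{\gamma_n}\rightharpoonup f$ weakly in $L^2(\Omega)$. Then there exist an adjoint state $p\in V$, a multiplier $\xi\in V'$ and a dual multiplier $q\in L^\infty(\Omega)$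 such that $$\begin{aligned} &\langle Au,v\rangle+\int_\Omega q\,v\,dx=\int_\Omega f\,v\,dx &&\text{for all }v\in V,\\ &q(x)\,u(x)=\beta|u(x)| &&\text{a.e. in }\Omega,\\ &|q(x)|\le\beta &&\text{a.e. in }\Omega,\\ &\langle A^*p,v\rangle+\langle\xi,v\rangle=\int_\Omega(u-z_d)\,v\,dx &&\text{for all }v\in V,\\ &\alpha f(x)+p(x)=0 &&\text{a.e. in }\Omega. \end{aligned}$$ -/

import Mathlib

open MeasureTheory Filter Topology

noncomputable section

namespace NonsmoothControl

/-- The real Hilbert space `L²(Ω)`. -/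
abbrev L2 {d : ℕ} (Ω : Set (EuclideanSpace ℝ (Fin d))) : Type :=
  Lp ℝ 2 (volume.restrict Ω)

/-- The space `L^∞(Ω)`. -/
abbrev LInf {d : ℕ} (Ω : Set (EuclideanSpace ℝ (Fin d))) : Type :=
  Lp ℝ ⊤ (volume.restrict Ω)

/-- Weak convergence of a sequence in the Hilbert space `L²(Ω)`. -/
def WeaklyConverges {d : ℕ} {Ω : Set (EuclideanSpace ℝ (Fin d))} (F : ℕ → L2 Ω) (f : L2 Ω) :
    Prop :=
  ∀ h : L2 Ω, Tendsto (fun n => ∫ x in Ω, F n x * h x) atTop (𝓝 (∫ x in Ω, f x * h x))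

/-- Reflexivity: the canonical map into the double dual is onto. -/
def IsReflexiveSpace (V : Type*) [NormedAddCommGroup V] [NormedSpace ℝ V] : Prop :=
  Function.Surjective (NormedSpace.inclusionInDoubleDual ℝ V)

/-- `V ↪ L²(Ω) ↪ V'`: the first map `ι` is a compact (continuous) injection; the second map,
`h ↦ (v ↦ ∫ h v)`, is automatically continuous, and injective. -/
structure IsGelfandTriple {d : ℕ} {Ω : Set (EuclideanSpace ℝ (Fin d))} {V : Type*}
    [NormedAddCommGroup V] [NormedSpace ℝ V] (ι : V →L[ℝ] L2 Ω) : Prop where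
  injective : Function.Injective ι
  compact : IsCompactOperator ι
  injective_dual : ∀ h : L2 Ω, (∀ v : V, ∫ x in Ω, h x * ι v x = 0) → h = 0

/-- Ellipticity of a bounded linear operator `A : V → V'`. -/
def IsElliptic {V : Type*} [NormedAddCommGroup V] [NormedSpace ℝ V]
    (A : V →L[ℝ] StrongDual ℝ V) : Prop :=
  ∃ c : ℝ, 0 < c ∧ ∀ v : V, c * ‖v‖ ^ 2 ≤ A v v

section Control

variable {d : ℕ} {Ω : Set (EuclideanSpace ℝ (Fin d))} {V : Type*} [NormedAddCommGroup V]
  [NormedSpace ℝ V]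

/-- The tracking type cost functional
`J(u, f) = 1/2 ∫ |u - z_d|² + α/2 ∫ |f|²`. -/
def cost (ι : V →L[ℝ] L2 Ω) (α : ℝ) (zd : L2 Ω) (u : V) (f : L2 Ω) : ℝ :=
  1 / 2 * (∫ x in Ω, |ι u x - zd x| ^ 2) + α / 2 * ∫ x in Ω, |f x| ^ 2

/-- `u` is a state for the control `f`: it solves the variational inequality of the second kind
`⟨A u, v - u⟩ + β ∫ |v| - β ∫ |u| ≥ ⟨f, v - u⟩` for all `v ∈ V`. -/
def IsState (ι : V →L[ℝ] L2 Ω) (A : V →L[ℝ] StrongDual ℝ V) (β : ℝ) (u : V) (f : L2 Ω) : Prop :=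
  ∀ v : V, ∫ x in Ω, f x * ι (v - u) x ≤
    A u (v - u) + β * (∫ x in Ω, |ι v x|) - β * ∫ x in Ω, |ι u x|

/-- `u` is a state of the problem regularized by the differentiable function `φ`:
`⟨A u, v⟩ + ∫ φ'(u) v = ⟨f, v⟩` for all `v ∈ V`, the integral being well defined. -/
def IsRegularizedState (ι : V →L[ℝ] L2 Ω) (A : V →L[ℝ] StrongDual ℝ V) (φ : ℝ → ℝ) (u : V)
    (f : L2 Ω) : Prop :=
  ∀ v : V, Integrable (fun x => deriv φ (ι u x) * ι v x) (volume.restrict Ω) ∧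
    A u v + ∫ x in Ω, deriv φ (ι u x) * ι v x = ∫ x in Ω, f x * ι v x

/-- `f`, with state `u`, is a local solution of the problem of minimizing `J(u, f)` subject to the
constraint `State u f`, local optimality being understood in the norm of the control space. -/
def IsLocalOptimal (State : V → L2 Ω → Prop) (J : V → L2 Ω → ℝ) (u : V) (f : L2 Ω) : Prop :=
  State u f ∧ ∃ r : ℝ, 0 < r ∧ ∀ (w : V) (g : L2 Ω), ‖g - f‖ < r → State w g → J u f ≤ J w g

end Control

/-- A family `φ_γ`, `γ > 0`, of smooth convex regularizations of the function `β |·|`. -/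
structure IsSmoothRegularization (β : ℝ) (φ : ℝ → ℝ → ℝ) : Prop where
  convex : ∀ γ : ℝ, 0 < γ → ConvexOn ℝ Set.univ (φ γ)
  contDiff : ∀ γ : ℝ, 0 < γ → ContDiff ℝ 1 (φ γ)
  tendsto : ∀ x : ℝ, Tendsto (fun γ => φ γ x) atTop (𝓝 (β * |x|))

/-- The regularization `β √(|x|² + γ⁻²)`. -/
def sqrtReg (β γ x : ℝ) : ℝ := β * √(|x| ^ 2 + (γ ^ 2)⁻¹)

/-- The regularization `β / (γ + 1) (γ |x|) ^ ((γ + 1) / γ)`. -/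
def powReg (β γ x : ℝ) : ℝ := β / (γ + 1) * (γ * |x|) ^ ((γ + 1) / γ)

theorem isSmoothRegularization_sqrtReg {β : ℝ} (hβ : 0 < β) :
    IsSmoothRegularization β (sqrtReg β) where
  convex γ hγ := by
    have h : sqrtReg β γ = fun x => β • ‖(Complex.mk x γ⁻¹)‖ := by
      funext x
      simp only [sqrtReg, Complex.norm_def, Complex.normSq_mk, smul_eq_mul, sq_abs]
      congr 2
      rw [← inv_pow]; ring
    rw [h]
    refine ConvexOn.smul hβ.le ⟨convex_univ, fun x _ y _ a b ha hb hab => ?_⟩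
    have e : Complex.mk (a • x + b • y) γ⁻¹ = (a : ℂ) * ⟨x, γ⁻¹⟩ + (b : ℂ) * ⟨y, γ⁻¹⟩ := by
      apply Complex.ext
      · simp
      · simp [← add_mul, hab]
    beta_reduce
    rw [e]
    refine (norm_add_le _ _).trans (le_of_eq ?_)
    simp [abs_of_nonneg ha, abs_of_nonneg hb]
  contDiff γ hγ := by
    unfold sqrtReg
    simp only [sq_abs]
    refine contDiff_const.mul (ContDiff.sqrt (by fun_prop) fun x => ?_)
    positivity
  tendsto x := by
    have h1 : Tendsto (fun γ : ℝ => (γ ^ 2)⁻¹) atTop (𝓝 0) :=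
      tendsto_inv_atTop_zero.comp (tendsto_pow_atTop two_ne_zero)
    have h2 := ((tendsto_const_nhds (x := |x| ^ 2)).add h1).sqrt.const_mul β
    simpa [sqrtReg, Real.sqrt_sq_eq_abs] using h2

theorem isSmoothRegularization_powReg {β : ℝ} (hβ : 0 < β) :
    IsSmoothRegularization β (powReg β) where
  convex γ hγ := by
    have hp : 1 ≤ (γ + 1) / γ := by rw [le_div_iff₀ hγ]; linarith
    have h : powReg β γ = fun x => (β / (γ + 1)) • (γ * |x|) ^ ((γ + 1) / γ) := rfl
    rw [h]
    refine ConvexOn.smul (by positivity) ⟨convex_univ, fun x _ y _ a b ha hb hab => ?_⟩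
    have hc := (convexOn_rpow hp).2 (x := γ * |x|) (y := γ * |y|)
      (Set.mem_Ici.2 (by positivity)) (Set.mem_Ici.2 (by positivity)) ha hb hab
    refine le_trans (Real.rpow_le_rpow (by positivity) ?_ (by positivity)) hc
    simp only [smul_eq_mul]
    have : |a * x + b * y| ≤ a * |x| + b * |y| := by
      refine (abs_add_le _ _).trans (le_of_eq ?_)
      rw [abs_mul, abs_mul, abs_of_nonneg ha, abs_of_nonneg hb]
    nlinarith
  contDiff γ hγ := by
    have hp : 1 < (γ + 1) / γ := by rw [lt_div_iff₀ hγ]; linarith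
    have h : powReg β γ = fun x => (β / (γ + 1) * γ ^ ((γ + 1) / γ)) * ‖x‖ ^ ((γ + 1) / γ) := by
      funext x
      simp only [powReg, Real.norm_eq_abs]
      rw [Real.mul_rpow hγ.le (abs_nonneg x)]; ring
    rw [h]
    exact contDiff_const.mul (contDiff_norm_rpow hp)
  tendsto x := by
    rcases eq_or_ne x 0 with rfl | hx
    · refine Tendsto.congr' (f₁ := fun _ => (0 : ℝ)) ?_ (by simp)
      filter_upwards [eventually_gt_atTop (0 : ℝ)] with γ hγ
      have : (γ + 1) / γ ≠ 0 := by positivity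
      simp [powReg, Real.zero_rpow this]
    · have hx' : 0 < |x| := abs_pos.2 hx
      have h1 : Tendsto (fun γ : ℝ => γ ^ (1 / γ)) atTop (𝓝 1) := tendsto_rpow_div
      have h0 : Tendsto (fun γ : ℝ => 1 / γ) atTop (𝓝 0) := by
        simpa using tendsto_inv_atTop_zero (𝕜 := ℝ)
      have h2 : Tendsto (fun γ : ℝ => |x| ^ (1 / γ)) atTop (𝓝 1) := by
        simpa using (tendsto_const_nhds (x := |x|)).rpow h0 (Or.inl hx'.ne')
      have h3 : Tendsto (fun γ : ℝ => (1 + 1 / γ)⁻¹) atTop (𝓝 1) := by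
        simpa using (h0.const_add 1).inv₀ (by norm_num)
      have h4 := ((h3.mul (h1.mul h2)).const_mul (β * |x|))
      simp only [mul_one] at h4
      refine h4.congr' ?_
      filter_upwards [eventually_gt_atTop (0 : ℝ)] with γ hγ
      have e : (γ + 1) / γ = 1 + 1 / γ := by field_simp
      rw [powReg, e, Real.rpow_add (by positivity), Real.rpow_one,
        Real.mul_rpow hγ.le hx'.le]
      have : (1 + 1 / γ)⁻¹ = γ / (γ + 1) := by field_simp
      rw [this]
      ring

end NonsmoothControl

end

/-!
Local optimality of `f` forces `f` into the range of `V`. By ellipticity the variational inequality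
has, for every control, a state depending on the control in a Lipschitz way for the norm of `V'`.
Moving from `f` to `f + t h` changes the tracking term by at most `C t ‖h‖_{V'} + O(t²)`, so that
optimality yields `|⟪f, h⟫| ≤ C ‖h‖_{V'}` for all `h ∈ L²`
(`IsLocalOptimal.exists_abs_inner_le`). The functional `⟪f, ·⟫` thus extends to an element of `V''`,
which by reflexivity is a point of `V` (`exists_eq_of_abs_inner_le`), and its multiple by `-α` is
the adjoint state `p`. The multiplier `ξ` is the residual of the adjoint equation.

The dual multiplier `q` comes from the variational inequality alone: testing with `v + u`, `0` and
`2 u` shows that `f - A u` is dominated by `β ∫ |·|` on `V`, with equality at `u`. Extending it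
by Hahn–Banach to `L²` gives a function `q` with `|q| ≤ β` and `∫ q u = β ∫ |u|`
(`IsState.exists_multiplier`).

States exist by minimization of the energy when `A` is symmetric, and in general by switching on the
skew part of `A` in small steps, each of them a contraction argument (`exists_solvesVI`).
-/

namespace NonsmoothControl

theorem nonneg_of_forall_small {a b δ : ℝ} (hδ : 0 < δ)
    (h : ∀ t : ℝ, 0 < t → t < δ → 0 ≤ a + t * b) : 0 ≤ a := by
  have h1 : Tendsto (fun t : ℝ => a + t * b) (𝓝[>] 0) (𝓝 a) := by
    have : Tendsto (fun t : ℝ => a + t * b) (𝓝 0) (𝓝 (a + 0 * b)) :=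
      Continuous.tendsto (by fun_prop) 0
    rw [zero_mul, add_zero] at this
    exact this.mono_left nhdsWithin_le_nhds
  refine ge_of_tendsto h1 ?_
  filter_upwards [Ioo_mem_nhdsGT hδ] with t ht using h t ht.1 ht.2

/-! ### Elliptic variational inequalities of the second kind -/

section VariationalInequality

variable {V : Type*} [NormedAddCommGroup V] [NormedSpace ℝ V]

/-- `u` solves the variational inequality of the second kind with operator `B`, functional `j` and
right-hand side `ℓ`. -/
def SolvesVI (B : V →L[ℝ] StrongDual ℝ V) (j : V → ℝ) (ℓ : StrongDual ℝ V) (u : V) : Prop :=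
  ∀ v : V, ℓ (v - u) ≤ B u (v - u) + j v - j u

theorem SolvesVI.norm_sub_le {B : V →L[ℝ] StrongDual ℝ V} {j : V → ℝ} {ℓ₁ ℓ₂ : StrongDual ℝ V}
    {u₁ u₂ : V} {c : ℝ} (hB : ∀ v, c * ‖v‖ ^ 2 ≤ B v v)
    (h₁ : SolvesVI B j ℓ₁ u₁) (h₂ : SolvesVI B j ℓ₂ u₂) : c * ‖u₁ - u₂‖ ≤ ‖ℓ₁ - ℓ₂‖ := by
  have e₁ := h₁ u₂
  have e₂ := h₂ u₁
  have hco := hB (u₁ - u₂)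
  have hle := (le_abs_self _).trans ((ℓ₁ - ℓ₂).le_opNorm (u₁ - u₂))
  simp only [map_sub, sub_apply] at e₁ e₂ hco hle
  rcases (norm_nonneg (u₁ - u₂)).eq_or_lt' with h0 | h0
  · rw [h0, mul_zero]; exact norm_nonneg _
  · refine le_of_mul_le_mul_right ?_ h0
    nlinarith

/-- For a symmetric operator the inequality is the optimality condition of the strongly convex
energy `1/2 ⟨B v, v⟩ + j v - ℓ v`, whose minimizing sequences are Cauchy. -/
theorem exists_solvesVI_of_symm [CompleteSpace V] {B : V →L[ℝ] StrongDual ℝ V} {c : ℝ}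
    (hc : 0 < c) (hB : ∀ v, c * ‖v‖ ^ 2 ≤ B v v) (hsymm : ∀ v w, B v w = B w v) {j : V → ℝ}
    (hj : ConvexOn ℝ Set.univ j) (hjc : Continuous j) (hj0 : ∀ v, 0 ≤ j v)
    (ℓ : StrongDual ℝ V) : ∃ u, SolvesVI B j ℓ u := by
  set Φ : V → ℝ := fun v => 1 / 2 * B v v + j v - ℓ v with hΦ
  have hΦc : Continuous Φ := by fun_prop
  have hbdd : BddBelow (Set.range Φ) := by
    refine ⟨-(‖ℓ‖ ^ 2 / (2 * c)), ?_⟩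
    rintro _ ⟨v, rfl⟩
    have h1 := (le_abs_self _).trans (ℓ.le_opNorm v)
    have h2 : ‖ℓ‖ * ‖v‖ ≤ c / 2 * ‖v‖ ^ 2 + ‖ℓ‖ ^ 2 / (2 * c) := by
      have : c / 2 * ‖v‖ ^ 2 + ‖ℓ‖ ^ 2 / (2 * c) - ‖ℓ‖ * ‖v‖ = (c * ‖v‖ - ‖ℓ‖) ^ 2 / (2 * c) := by
        field_simp; ring
      have : 0 ≤ (c * ‖v‖ - ‖ℓ‖) ^ 2 / (2 * c) := by positivity
      linarith
    have := hB v
    have := hj0 v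
    simp only [hΦ]
    linarith
  set m := ⨅ v, Φ v
  have hmle : ∀ v, m ≤ Φ v := fun v => ciInf_le hbdd v
  -- The parallelogram identity turns near-minimality into smallness of distances.
  have hpar : ∀ v w : V, c / 4 * ‖v - w‖ ^ 2 ≤ Φ v + Φ w - 2 * m := by
    intro v w
    have h1 := hmle ((1 / 2 : ℝ) • v + (1 / 2 : ℝ) • w)
    have h2 := hj.2 (Set.mem_univ v) (Set.mem_univ w) (by norm_num : (0 : ℝ) ≤ 1 / 2)
      (by norm_num : (0 : ℝ) ≤ 1 / 2) (by norm_num)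
    have h3 := hB (v - w)
    have h4 := hsymm v w
    simp only [hΦ, map_add, map_sub, map_smul, add_apply,
      sub_apply, smul_apply, smul_eq_mul] at h1 h2 h3 ⊢
    linarith
  have hex : ∀ n : ℕ, ∃ v, Φ v < m + 1 / ((n : ℝ) + 1) := fun n =>
    exists_lt_of_ciInf_lt (lt_add_of_pos_right _ (by positivity))
  choose w hw using hex
  have hlim : Tendsto (fun n : ℕ => 1 / ((n : ℝ) + 1)) atTop (𝓝 0) :=
    tendsto_one_div_add_atTop_nhds_zero_nat
  have hcau : CauchySeq w := by
    refine cauchySeq_of_le_tendsto_0 (fun n : ℕ => √(8 / c * (1 / ((n : ℝ) + 1)))) ?_ ?_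
    · intro n k N hn hk
      rw [dist_eq_norm]
      refine Real.le_sqrt_of_sq_le ?_
      have h1 := hpar (w n) (w k)
      have h2 := Nat.one_div_le_one_div (α := ℝ) hn
      have h3 := Nat.one_div_le_one_div (α := ℝ) hk
      have h4 : c / 4 * ‖w n - w k‖ ^ 2 ≤ 2 * (1 / ((N : ℝ) + 1)) := by
        linarith [hw n, hw k]
      have h5 : 8 / c * (1 / ((N : ℝ) + 1)) = 4 / c * (2 * (1 / ((N : ℝ) + 1))) := by ring
      have h6 : ‖w n - w k‖ ^ 2 = 4 / c * (c / 4 * ‖w n - w k‖ ^ 2) := by field_simp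
      rw [h5, h6]
      gcongr
    · simpa using (hlim.const_mul (8 / c)).sqrt
  obtain ⟨u, hu⟩ := cauchySeq_tendsto_of_complete hcau
  have hmin : Φ u ≤ m := by
    have h2 := hlim.const_add m
    rw [add_zero] at h2
    exact le_of_tendsto_of_tendsto' ((hΦc.tendsto u).comp hu) h2 fun n => (hw n).le
  refine ⟨u, fun v => ?_⟩
  suffices 0 ≤ B u (v - u) + j v - j u - ℓ (v - u) by linarith
  refine nonneg_of_forall_small (b := 1 / 2 * B (v - u) (v - u)) one_pos fun t ht ht1 => ?_
  have h1 := hmin.trans (hmle ((1 - t) • u + t • v))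
  have h2 := hj.2 (Set.mem_univ u) (Set.mem_univ v) (by linarith : (0 : ℝ) ≤ 1 - t) ht.le (by ring)
  have h4 := hsymm u v
  simp only [hΦ, map_add, map_sub, map_smul, add_apply,
    sub_apply, smul_apply, smul_eq_mul] at h1 h2 ⊢
  refine nonneg_of_mul_nonneg_right (b := _) ?_ ht
  rw [h4] at h1 ⊢
  nlinarith

/-- A perturbation of the operator smaller than its ellipticity constant preserves solvability, by
Banach's fixed point theorem. -/
theorem exists_solvesVI_add [CompleteSpace V] {B K : V →L[ℝ] StrongDual ℝ V} {c : ℝ}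
    (hB : ∀ v, c * ‖v‖ ^ 2 ≤ B v v) (hK : ‖K‖ < c) {j : V → ℝ}
    (h : ∀ ℓ, ∃ u, SolvesVI B j ℓ u) (ℓ : StrongDual ℝ V) : ∃ u, SolvesVI (B + K) j ℓ u := by
  have hc : 0 < c := (norm_nonneg K).trans_lt hK
  choose S hS using h
  have hcontr : ContractingWith (‖K‖ / c).toNNReal fun u => S (ℓ - K u) := by
    refine ⟨?_, LipschitzWith.of_dist_le_mul fun v w => ?_⟩
    · rw [Real.toNNReal_lt_one, div_lt_one hc]
      exact hK
    · rw [Real.coe_toNNReal _ (by positivity), dist_eq_norm, dist_eq_norm]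
      have h1 := (hS (ℓ - K v)).norm_sub_le hB (hS (ℓ - K w))
      have h2 : ‖(ℓ - K v) - (ℓ - K w)‖ ≤ ‖K‖ * ‖v - w‖ := by
        rw [sub_sub_sub_cancel_left, ← map_sub, norm_sub_rev v w]
        exact K.le_opNorm _
      rw [div_mul_eq_mul_div, le_div_iff₀ hc]
      linarith
  have hfix : S (ℓ - K hcontr.fixedPoint) = hcontr.fixedPoint := hcontr.fixedPoint_isFixedPt
  refine ⟨hcontr.fixedPoint, fun v => ?_⟩
  have h1 := hS (ℓ - K hcontr.fixedPoint) v
  rw [hfix] at h1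
  simp only [sub_apply, add_apply] at h1 ⊢
  linarith

/-- Solvability for a nonsymmetric operator: the skew part does not affect ellipticity, so it can
be switched on in finitely many small steps. -/
theorem exists_solvesVI [CompleteSpace V] {A : V →L[ℝ] StrongDual ℝ V} {c : ℝ}
    (hc : 0 < c) (hA : ∀ v, c * ‖v‖ ^ 2 ≤ A v v) {j : V → ℝ}
    (hj : ConvexOn ℝ Set.univ j) (hjc : Continuous j) (hj0 : ∀ v, 0 ≤ j v)
    (ℓ : StrongDual ℝ V) : ∃ u, SolvesVI A j ℓ u := by
  set S : V →L[ℝ] StrongDual ℝ V := (1 / 2 : ℝ) • (A + A.flip) with hS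
  set K : V →L[ℝ] StrongDual ℝ V := (1 / 2 : ℝ) • (A - A.flip) with hK
  obtain ⟨N, hN⟩ := exists_nat_gt (‖K‖ / c)
  have hN0 : (0 : ℝ) < N := lt_of_le_of_lt (by positivity) hN
  have hsmall : ‖(1 / (N : ℝ)) • K‖ < c := by
    refine (ContinuousLinearMap.opNorm_smul_le _ _).trans_lt ?_
    rw [Real.norm_of_nonneg (by positivity), one_div_mul_eq_div, div_lt_iff₀ hN0]
    rwa [div_lt_iff₀ hc, mul_comm] at hN
  have hstep : ∀ n : ℕ, ∀ ℓ, ∃ u, SolvesVI (S + (n : ℝ) • (1 / (N : ℝ)) • K) j ℓ u := by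
    intro n
    induction n with
    | zero =>
      intro ℓ
      refine exists_solvesVI_of_symm hc (fun v => ?_) (fun v w => ?_) hj hjc hj0 ℓ
      · refine (hA v).trans_eq ?_
        simp [hS]; ring
      · simp [hS]; ring
    | succ n ih =>
      intro ℓ
      have hcoer : ∀ v, c * ‖v‖ ^ 2 ≤ (S + (n : ℝ) • (1 / (N : ℝ)) • K) v v := fun v => by
        refine (hA v).trans_eq ?_
        simp [hS, hK]; ring
      obtain ⟨u, hu⟩ := exists_solvesVI_add hcoer hsmall ih ℓ
      refine ⟨u, ?_⟩
      convert hu using 1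
      ext v w
      simp; ring
  obtain ⟨u, hu⟩ := hstep N ℓ
  have hSK : S + (N : ℝ) • (1 / (N : ℝ)) • K = A := by
    ext v w
    simp [hS, hK]
    field_simp
    ring
  rw [hSK] at hu
  exact ⟨u, hu⟩

end VariationalInequality

/-! ### The `L¹` seminorm on `L²` -/

section LebesgueSpace

variable {X : Type*} [MeasurableSpace X] {μ : Measure X}

theorem inner_eq_integral_mul (g h : Lp ℝ 2 μ) : inner ℝ g h = ∫ x, g x * h x ∂μ := by
  rw [L2.inner_def]
  refine integral_congr_ae (ae_of_all _ fun x => ?_)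
  simp [mul_comm]

theorem integral_abs_sq_eq_norm_sq (h : Lp ℝ 2 μ) : ∫ x, |h x| ^ 2 ∂μ = ‖h‖ ^ 2 := by
  rw [← real_inner_self_eq_norm_sq, inner_eq_integral_mul]
  simp only [sq_abs]
  simp only [sq]

variable [IsFiniteMeasure μ]

theorem integrable_of_L2 (h : Lp ℝ 2 μ) : Integrable h μ :=
  (Lp.memLp h).integrable (by norm_num)

variable (μ) in
/-- The seminorm `h ↦ ∫ |h|` on `L²` of a finite measure. -/
noncomputable def l1Seminorm : Seminorm ℝ (Lp ℝ 2 μ) :=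
  Seminorm.of (fun h => ∫ x, |h x| ∂μ)
    (fun g h => by
      rw [← integral_add (integrable_of_L2 g).abs (integrable_of_L2 h).abs]
      refine integral_mono_ae (integrable_of_L2 _).abs
        ((integrable_of_L2 g).abs.add (integrable_of_L2 h).abs) ?_
      filter_upwards [Lp.coeFn_add g h] with x hx
      rw [hx]
      exact abs_add_le _ _)
    (fun a h => by
      rw [← integral_const_mul]
      refine integral_congr_ae ?_
      filter_upwards [Lp.coeFn_smul a h] with x hx
      rw [hx]
      simp [abs_mul])

theorem l1Seminorm_apply (h : Lp ℝ 2 μ) : l1Seminorm μ h = ∫ x, |h x| ∂μ := rfl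

theorem l1Seminorm_le_norm (h : Lp ℝ 2 μ) :
    l1Seminorm μ h ≤ ‖Lp.const 2 μ (1 : ℝ)‖ * ‖h‖ := by
  have h1 := real_inner_le_norm (Lp.const 2 μ (1 : ℝ)) |h|
  rw [norm_abs_eq_norm] at h1
  refine le_of_eq_of_le ?_ h1
  rw [inner_eq_integral_mul, l1Seminorm_apply]
  refine integral_congr_ae ?_
  filter_upwards [Lp.coeFn_const 2 μ (1 : ℝ), Lp.coeFn_abs h] with x hx hx'
  rw [hx, hx']
  simp

theorem continuous_l1Seminorm : Continuous (l1Seminorm μ) := by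
  refine Seminorm.continuous_of_le
    (q := ‖Lp.const 2 μ (1 : ℝ)‖₊ • normSeminorm ℝ (Lp ℝ 2 μ)) ?_ ?_
  · exact continuous_norm.const_smul ‖Lp.const 2 μ (1 : ℝ)‖₊
  · intro h
    exact l1Seminorm_le_norm h

/-- If integration against `q` is dominated by `β ∫ |h|`, then `q ≤ β`: test with indicators. -/
theorem ae_le_of_inner_le {q : Lp ℝ 2 μ} {β : ℝ}
    (hq : ∀ h, inner ℝ q h ≤ β * l1Seminorm μ h) : ∀ᵐ x ∂μ, q x ≤ β := by
  refine ae_le_of_forall_setIntegral_le (integrable_of_L2 q) (integrable_const β)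
    fun s hs hs' => ?_
  have h1 := hq (indicatorConstLp 2 hs hs'.ne (1 : ℝ))
  rw [real_inner_comm, L2.inner_indicatorConstLp_one, l1Seminorm_apply] at h1
  refine h1.trans_eq ?_
  rw [← integral_const_mul, ← integral_indicator hs]
  refine integral_congr_ae ?_
  filter_upwards [indicatorConstLp_coeFn (p := 2) (hs := hs) (hμs := hs'.ne) (c := (1 : ℝ))]
    with x hx
  rw [hx]
  by_cases hxs : x ∈ s <;> simp [hxs]

end LebesgueSpace

/-! ### The pairing of `L²` with `V` -/

section Pairing

variable {V H : Type*} [NormedAddCommGroup V] [NormedSpace ℝ V] [NormedAddCommGroup H]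
  [InnerProductSpace ℝ H]

/-- The embedding `h ↦ ⟪h, ι ·⟫` of the pivot space `H` into `V'`. -/
noncomputable def dualEmbedding (ι : V →L[ℝ] H) : H →L[ℝ] StrongDual ℝ V :=
  (ContinuousLinearMap.compL ℝ V H ℝ).flip ι ∘L innerSL ℝ

@[simp]
theorem dualEmbedding_apply (ι : V →L[ℝ] H) (h : H) (v : V) :
    dualEmbedding ι h v = inner ℝ h (ι v) := rfl

/-- If `⟪f, ·⟫` is bounded for the norm of `V'`, then `f` lies in the range of `ι`: extend the
functional to `V'` and represent the extension by reflexivity. -/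
theorem exists_eq_of_abs_inner_le (hV : IsReflexiveSpace V) {ι : V →L[ℝ] H}
    (hι : Function.Injective (dualEmbedding ι)) {f : H} {C : ℝ}
    (hC : ∀ h, |inner ℝ f h| ≤ C * ‖dualEmbedding ι h‖) : ∃ p : V, ι p = f := by
  set e := LinearEquiv.ofInjective (dualEmbedding ι).toLinearMap hι
  let l : (dualEmbedding ι).toLinearMap.range →ₗ[ℝ] ℝ :=
    (innerSL ℝ f).toLinearMap ∘ₗ e.symm.toLinearMap
  have hl : ∀ h, l (e h) = inner ℝ f h := fun h => by
    change inner ℝ f (e.symm (e h)) = _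
    rw [e.symm_apply_apply]
  have hlC : ∀ y, ‖l y‖ ≤ C * ‖y‖ := fun y => by
    obtain ⟨h, rfl⟩ := e.surjective y
    rw [hl]
    exact hC h
  let g₀ : StrongDual ℝ (dualEmbedding ι).toLinearMap.range :=
    ⟨l, AddMonoidHomClass.continuous_of_bound l C hlC⟩
  obtain ⟨g, hg, -⟩ := exists_extension_norm_eq _ g₀
  obtain ⟨p, hp⟩ := hV g
  refine ⟨p, ext_inner_right ℝ fun h => ?_⟩
  have h1 : g (dualEmbedding ι h) = inner ℝ f h := by
    rw [← hl]
    exact hg (e h)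
  rw [← h1, ← hp, NormedSpace.dual_def, dualEmbedding_apply, real_inner_comm]

end Pairing

/-! ### Multipliers and adjoint state -/

section Control

variable {d : ℕ} {Ω : Set (EuclideanSpace ℝ (Fin d))} {V : Type*} [NormedAddCommGroup V]
  [NormedSpace ℝ V] {ι : V →L[ℝ] L2 Ω}

theorem IsGelfandTriple.injective_dualEmbedding (hι : IsGelfandTriple ι) :
    Function.Injective (dualEmbedding ι) := by
  rw [injective_iff_map_eq_zero]
  refine fun h hh => hι.injective_dual h fun v => ?_
  rw [← inner_eq_integral_mul, ← dualEmbedding_apply, hh, zero_apply]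

theorem cost_eq_norm (α : ℝ) (zd : L2 Ω) (u : V) (f : L2 Ω) :
    cost ι α zd u f = 1 / 2 * ‖ι u - zd‖ ^ 2 + α / 2 * ‖f‖ ^ 2 := by
  rw [cost, integral_abs_sq_eq_norm_sq, ← integral_abs_sq_eq_norm_sq (ι u - zd)]
  congr 2
  refine integral_congr_ae ?_
  filter_upwards [Lp.coeFn_sub (ι u) zd] with x hx
  rw [hx, Pi.sub_apply]

variable [IsFiniteMeasure (volume.restrict Ω)] {A : V →L[ℝ] StrongDual ℝ V} {β : ℝ}

theorem isState_iff_solvesVI {u : V} {f : L2 Ω} : IsState ι A β u f ↔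
    SolvesVI A (fun v => β * l1Seminorm _ (ι v)) (dualEmbedding ι f) u := by
  simp only [IsState, SolvesVI, dualEmbedding_apply, inner_eq_integral_mul, l1Seminorm_apply]

theorem exists_isState [CompleteSpace V] (hA : IsElliptic A) (hβ : 0 ≤ β) (f : L2 Ω) :
    ∃ u, IsState ι A β u f := by
  obtain ⟨c, hc, hco⟩ := hA
  simp only [isState_iff_solvesVI]
  refine exists_solvesVI hc hco ?_ ?_ (fun v => by positivity) _
  · exact ((l1Seminorm _).comp ι.toLinearMap).convexOn.smul hβ
  · exact (continuous_l1Seminorm.comp ι.continuous).const_mul β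

/-- Comparing the cost at `f + t h` with the cost at `f` for small `t > 0`: as the state depends on
the control in a Lipschitz way for the norm of `V'`, the first order change of the tracking term is
at most a multiple of `‖h‖_{V'}`, and so is that of the control term. -/
theorem IsLocalOptimal.exists_abs_inner_le [CompleteSpace V] (hA : IsElliptic A) (hβ : 0 ≤ β)
    {α : ℝ} (hα : 0 < α) {zd f : L2 Ω} {u : V}
    (hf : IsLocalOptimal (IsState ι A β) (cost ι α zd) u f) :
    ∃ C, ∀ h, |inner ℝ f h| ≤ C * ‖dualEmbedding ι h‖ := by
  obtain ⟨c, hc, hco⟩ := id hA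
  obtain ⟨hu, r, hr, hmin⟩ := hf
  set a := ‖ι u - zd‖
  have key : ∀ h : L2 Ω, -inner ℝ f h ≤ a * ‖ι‖ / (α * c) * ‖dualEmbedding ι h‖ := by
    intro h
    set D := ‖ι‖ * ‖dualEmbedding ι h‖ / c with hD
    have hδ : 0 < r / (‖h‖ + 1) := by positivity
    have hfirst : 0 ≤ a * D + α * inner ℝ f h := by
      refine nonneg_of_forall_small (b := D ^ 2 / 2 + α * ‖h‖ ^ 2 / 2) hδ fun t ht htδ => ?_
      obtain ⟨w, hw⟩ := exists_isState (ι := ι) hA hβ (f + t • h)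
      have hclose : ‖f + t • h - f‖ < r := by
        rw [add_sub_cancel_left, norm_smul, Real.norm_of_nonneg ht.le]
        rw [lt_div_iff₀ (by positivity)] at htδ
        nlinarith
      have hJ := hmin w _ hclose hw
      rw [cost_eq_norm, cost_eq_norm, norm_add_sq_real, real_inner_smul_right, norm_smul,
        Real.norm_of_nonneg ht.le] at hJ
      have hlip : ‖w - u‖ ≤ t * ‖dualEmbedding ι h‖ / c := by
        have h1 := (isState_iff_solvesVI.1 hw).norm_sub_le hco (isState_iff_solvesVI.1 hu)
        rw [← map_sub, add_sub_cancel_left, map_smul, norm_smul, Real.norm_of_nonneg ht.le] at h1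
        rw [le_div_iff₀ hc]
        linarith
      have hdist : ‖ι w - zd‖ ≤ a + t * D := by
        have h1 : ι w - zd = (ι u - zd) + ι (w - u) := by rw [map_sub]; abel
        rw [h1]
        refine (norm_add_le _ _).trans (add_le_add_right ?_ a)
        refine (ι.le_opNorm _).trans ((mul_le_mul_of_nonneg_left hlip (norm_nonneg ι)).trans_eq ?_)
        rw [hD]; ring
      have hsq : ‖ι w - zd‖ ^ 2 ≤ (a + t * D) ^ 2 := by gcongr
      refine nonneg_of_mul_nonneg_right (b := _) ?_ ht
      change 1 / 2 * a ^ 2 + _ ≤ _ at hJ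
      linarith
    have h2 : a * ‖ι‖ / (α * c) * ‖dualEmbedding ι h‖ = a * D / α := by rw [hD]; field_simp
    rw [h2, le_div_iff₀ hα]
    linarith
  refine ⟨_, fun h => abs_le'.2 ⟨?_, key h⟩⟩
  have := key (-h)
  rwa [inner_neg_right, neg_neg, map_neg, norm_neg] at this

/-- The residual `f - A u` is dominated on `V` by `β ∫ |·|`; its Hahn–Banach extension to `L²` is
represented by a function bounded by `β`. -/
theorem IsState.exists_multiplier (hι : Function.Injective ι) (hβ : 0 ≤ β) {u : V} {f : L2 Ω}
    (hu : IsState ι A β u f) : ∃ q : LInf Ω,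
      (∀ v : V, A u v + ∫ x in Ω, q x * ι v x = ∫ x in Ω, f x * ι v x) ∧
      (∀ᵐ x ∂volume.restrict Ω, q x * ι u x = β * |ι u x|) ∧
      (∀ᵐ x ∂volume.restrict Ω, |q x| ≤ β) := by
  set N := l1Seminorm (volume.restrict Ω) with hN
  have hVI := isState_iff_solvesVI.1 hu
  -- The choices `v = 0` and `v = u + u` test the inequality along the ray through `u`.
  have h0 := hVI 0
  have h2 := hVI (u + u)
  have hres : ∀ v, inner ℝ f (ι v) - A u v ≤ β * N (ι v) := by
    intro v
    have h1 := hVI (v + u)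
    have h3 := map_add_le_add N (ι v) (ι u)
    simp only [add_sub_cancel_right, map_add, dualEmbedding_apply] at h1
    nlinarith
  have hNu : N (ι u + ι u) = 2 * N (ι u) := by
    rw [← two_smul ℝ, map_smul_eq_mul]; norm_num
  simp only [zero_sub, map_neg, map_zero, add_sub_cancel_right, dualEmbedding_apply, map_add]
    at h0 h2
  rw [← hN, hNu] at h2
  have hresu : inner ℝ f (ι u) - A u u = β * N (ι u) := by linarith
  set e := LinearEquiv.ofInjective ι.toLinearMap hι
  set R : L2 Ω →ₗ.[ℝ] ℝ := ⟨ι.toLinearMap.range,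
    (dualEmbedding ι f - A u).toLinearMap ∘ₗ e.symm.toLinearMap⟩
  have hRe : ∀ v, R (e v) = inner ℝ f (ι v) - A u v := fun v => by
    change (dualEmbedding ι f - A u) (e.symm (e v)) = _
    rw [e.symm_apply_apply]
    rfl
  obtain ⟨g, hg, hgN⟩ := exists_extension_of_le_sublinear R (fun h => β * N h)
    (fun t ht h => by
      simp only [map_smul_eq_mul, Real.norm_of_nonneg ht.le]
      ring)
    (fun h k => by
      rw [← mul_add]
      exact mul_le_mul_of_nonneg_left (map_add_le_add N h k) hβ)
    (fun y => by
      obtain ⟨v, rfl⟩ := e.surjective y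
      rw [hRe]
      exact hres v)
  have hgι : ∀ v, g (ι v) = inner ℝ f (ι v) - A u v := fun v => by rw [← hRe, ← hg]; rfl
  set κ := ‖Lp.const 2 (volume.restrict Ω) (1 : ℝ)‖
  have hgb : ∀ h, g h ≤ β * κ * ‖h‖ := fun h => by
    rw [mul_assoc]
    exact (hgN h).trans (mul_le_mul_of_nonneg_left (l1Seminorm_le_norm h) hβ)
  set G : StrongDual ℝ (L2 Ω) := g.mkContinuous (β * κ) fun h => abs_le'.2 ⟨hgb h, by
    simpa using hgb (-h)⟩
  set q₀ : L2 Ω := (InnerProductSpace.toDual ℝ (L2 Ω)).symm G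
  have hq₀ : ∀ h, inner ℝ q₀ h = g h := fun h => InnerProductSpace.toDual_symm_apply
  have hle : ∀ᵐ x ∂volume.restrict Ω, q₀ x ≤ β := ae_le_of_inner_le fun h => by
    rw [hq₀]; exact hgN h
  have hge : ∀ᵐ x ∂volume.restrict Ω, (-q₀ : L2 Ω) x ≤ β := ae_le_of_inner_le fun h => by
    have := hgN (-h)
    rwa [map_neg, map_neg_eq_map, ← hq₀, ← inner_neg_left] at this
  have habs : ∀ᵐ x ∂volume.restrict Ω, |q₀ x| ≤ β := by
    filter_upwards [hle, hge, Lp.coeFn_neg q₀] with x h1 h3 h4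
    rw [h4, Pi.neg_apply] at h3
    exact abs_le'.2 ⟨h1, h3⟩
  have hmem : MemLp q₀ ⊤ (volume.restrict Ω) :=
    memLp_top_of_bound (Lp.aestronglyMeasurable q₀) β habs
  have hcoe : hmem.toLp q₀ =ᵐ[volume.restrict Ω] q₀ := hmem.coeFn_toLp
  refine ⟨hmem.toLp q₀, fun v => ?_, ?_, ?_⟩
  · have h1 : ∫ x in Ω, hmem.toLp q₀ x * ι v x = inner ℝ q₀ (ι v) := by
      rw [inner_eq_integral_mul]
      refine integral_congr_ae ?_
      filter_upwards [hcoe] with x hx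
      rw [hx]
    rw [h1, hq₀, hgι, ← inner_eq_integral_mul]
    ring
  · -- The nonnegative function `β |u| - q u` has integral zero.
    have hqi : Integrable (fun x => q₀ x * ι u x) (volume.restrict Ω) :=
      (Lp.memLp q₀).integrable_mul (Lp.memLp (ι u))
    have hint : Integrable (fun x => β * |ι u x| - q₀ x * ι u x) (volume.restrict Ω) :=
      ((integrable_of_L2 (ι u)).abs.const_mul β).sub hqi
    have hnn : 0 ≤ᵐ[volume.restrict Ω] fun x => β * |ι u x| - q₀ x * ι u x := by
      filter_upwards [habs] with x hx
      have h1 := le_abs_self (q₀ x * ι u x)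
      rw [abs_mul] at h1
      have h3 := mul_le_mul_of_nonneg_right hx (abs_nonneg (ι u x))
      simp only [Pi.zero_apply]
      linarith
    have hzero : ∫ x in Ω, (β * |ι u x| - q₀ x * ι u x) = 0 := by
      rw [integral_sub ((integrable_of_L2 (ι u)).abs.const_mul β) hqi, integral_const_mul,
        ← l1Seminorm_apply, ← inner_eq_integral_mul, hq₀, hgι, hresu, sub_self]
    filter_upwards [(integral_eq_zero_iff_of_nonneg_ae hnn hint).1 hzero, hcoe] with x hx hx'
    rw [hx']
    simp only [Pi.zero_apply] at hx
    linarith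
  · filter_upwards [hcoe, habs] with x hx hx'
    rwa [hx]

end Control

end NonsmoothControl

theorem mainTheorem3 {d : ℕ} (Ω : Set (EuclideanSpace ℝ (Fin d)))
    (hΩ_open : IsOpen Ω) (hΩ_conn : IsConnected Ω) (hΩ_bdd : Bornology.IsBounded Ω)
    {V : Type*} [NormedAddCommGroup V] [NormedSpace ℝ V] [CompleteSpace V]
    (hV : NonsmoothControl.IsReflexiveSpace V)
    (ι : V →L[ℝ] NonsmoothControl.L2 Ω) (hι : NonsmoothControl.IsGelfandTriple ι)
    (A : V →L[ℝ] StrongDual ℝ V) (hA : NonsmoothControl.IsElliptic A)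
    (α β : ℝ) (hα : 0 < α) (hβ : 0 < β) (zd : NonsmoothControl.L2 Ω)
    (φ : ℝ → ℝ → ℝ) (hφ : NonsmoothControl.IsSmoothRegularization β φ)
    (f : NonsmoothControl.L2 Ω) (u : V)
    (hf : NonsmoothControl.IsLocalOptimal (NonsmoothControl.IsState ι A β)
      (NonsmoothControl.cost ι α zd) u f)
    (γ : ℕ → ℝ) (hγ_pos : ∀ n, 0 < γ n) (hγ : Tendsto γ atTop atTop)
    (fγ : ℕ → NonsmoothControl.L2 Ω)
    (hfγ : ∀ n, ∃ uγ : V, NonsmoothControl.IsLocalOptimal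
      (NonsmoothControl.IsRegularizedState ι A (φ (γ n)))
      (NonsmoothControl.cost ι α zd) uγ (fγ n))
    (hweak : NonsmoothControl.WeaklyConverges fγ f) :
    ∃ (p : V) (ξ : StrongDual ℝ V) (q : NonsmoothControl.LInf Ω),
      (∀ v : V, A u v + ∫ x in Ω, q x * ι v x = ∫ x in Ω, f x * ι v x) ∧
      (∀ᵐ x ∂volume.restrict Ω, q x * ι u x = β * |ι u x|) ∧
      (∀ᵐ x ∂volume.restrict Ω, |q x| ≤ β) ∧
      (∀ v : V, A.flip p v + ξ v = ∫ x in Ω, (ι u x - zd x) * ι v x) ∧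
      (∀ᵐ x ∂volume.restrict Ω, α * f x + ι p x = 0) := by
  have : IsFiniteMeasure (volume.restrict Ω) := isFiniteMeasure_restrict.2 hΩ_bdd.measure_lt_top.ne
  obtain ⟨C, hC⟩ := hf.exists_abs_inner_le hA hβ.le hα
  obtain ⟨p, hp⟩ := NonsmoothControl.exists_eq_of_abs_inner_le hV hι.injective_dualEmbedding hC
  obtain ⟨q, hq, hqu, hqβ⟩ := hf.1.exists_multiplier hι.injective hβ.le
  -- The adjoint equation determines `ξ` once `p` is chosen.
  refine ⟨-(α • p), NonsmoothControl.dualEmbedding ι (ι u - zd) - A.flip (-(α • p)), q, hq, hqu,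
    hqβ, fun v => ?_, ?_⟩
  · rw [sub_apply, add_sub_cancel, NonsmoothControl.dualEmbedding_apply,
      NonsmoothControl.inner_eq_integral_mul]
    refine integral_congr_ae ?_
    filter_upwards [Lp.coeFn_sub (ι u) zd] with x hx
    rw [hx, Pi.sub_apply]
  · rw [map_neg, map_smul, hp]
    filter_upwards [Lp.coeFn_neg (α • f), Lp.coeFn_smul α f] with x hx hx'
    rw [hx, Pi.neg_apply, hx', Pi.smul_apply, smul_eq_mul, add_neg_cancel]
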